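/- Let $k$ be a commutative ring and let $R$ be a unital associative $k$-algebra that is free as a $k$-module. Let $\mathfrak{sl}_3(R)$ be the $k$-Lie subalgebra of $\mathfrak{gl}_3(R)$ generated by the matrices $sE_{ij}$ with $s\in R$ and $i\neq j$. A central extension of a $k$-Lie algebra $\mathfrak{g}$ is a surjective homomorphism of $k$-Lie algebras $\mathcal{L}\to\mathfrak{g}$ whose kernel lies in the center of $\mathcal{L}$; it is universal if it factors through every central extension $\mathcal{M}\to\mathfrak{g}$ by exactly one homomorphism $\mathcal{L}\to\mathcal{M}$. Let $\mathfrak{p}$ be the $k$-Lie algebra presented by the generators $\{X_{ij}(s) : s\in R,\ 1\le i\neq j\le 3\}$ and the following relations, for all $a,b\in R$ and all indices in $\{1,2,3\}$ for which the symbols are defined: 1. $a\mapsto X_{ij}(a)$ is $k$-linear; 2. $[X_{ij}(a),X_{jl}(b)]=X_{il}(ab)$ for distinct $i,j,l$; 3. $[X_{ij}(a),X_{ij}(b)]=0$; 4. $[w,[X_{ij}(a),X_{pq}(b)]]=0$ for every generator $w$, whenever $i=p$ or $j=q$. Then $\mathfrak{p}$ is the universal central extension of $\mathfrak{sl}_3(R)$.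 That is, there is a homomorphism $\pi:\mathfrak{p}\to\mathfrak{sl}_3(R)$ with $\pi(X_{ij}(s))=sE_{ij}$ for all $i\ne j$ and $s\in R$, it is a universal central extension, and for every universal central extension $f:\mathcal{L}\to\mathfrak{sl}_3(R)$ there is exactly one isomorphism $e:\mathfrak{p}\to\mathcal{L}$ with $f\circ e=\pi$. -/

import Mathlib

/-!
Central and universal central extensions of Lie algebras, the Lie algebra `sl_n(R)` over an
associative algebra `R`, and the Lie algebra given by generators `X_ij(s)` and relations.
-/

universe u v w w'

attribute [local instance 100] LieRing.ofAssociativeRing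

/-- A central extension of Lie algebras over `k`: a surjective homomorphism whose kernel lies in
the center of the source (so that the kernel is in particular abelian). -/
structure IsCentralExtension (k : Type*) {L : Type*} {g : Type*} [CommRing k]
    [LieRing L] [LieAlgebra k L] [LieRing g] [LieAlgebra k g] (f : L →ₗ⁅k⁆ g) : Prop where
  surjective : Function.Surjective f
  ker_le_center : f.ker ≤ LieAlgebra.center k L

/-- A universal central extension: a central extension `f : L → g` such that for every central
extension `p : M → g` there is exactly one homomorphism `h : L → M` with `p ∘ h = f`.
The universe `w₀` of the extensions `M` is the first universe parameter. -/
structure IsUniversalCentralExtension.{w₀, u₁, u₂, u₃} (k : Type u₁) {L : Type u₂} {g : Type u₃}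
    [CommRing k] [LieRing L] [LieAlgebra k L] [LieRing g] [LieAlgebra k g]
    (f : L →ₗ⁅k⁆ g) : Prop where
  isCentralExtension : IsCentralExtension k f
  existsUnique_lift : ∀ (M : Type w₀) [LieRing M] [LieAlgebra k M] (p : M →ₗ⁅k⁆ g),
    IsCentralExtension k p → ∃! h : L →ₗ⁅k⁆ M, p.comp h = f

/-- `sl_n(R)`: the `k`-Lie subalgebra of `gl_n(R)` generated by the matrices `s E_ij`
with `i ≠ j` and `s ∈ R`. -/
def slAlg (k : Type u) (R : Type v) [CommRing k] [Ring R] [Algebra k R] (n : ℕ) :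
    LieSubalgebra k (Matrix (Fin n) (Fin n) R) :=
  LieSubalgebra.lieSpan k (Matrix (Fin n) (Fin n) R)
    {A | ∃ (i j : Fin n) (s : R), i ≠ j ∧ A = Matrix.single i j s}

/-- The index set of the generators `X_ij(s)`, where `1 ≤ i ≠ j ≤ 3` and `s ∈ R`. -/
structure SlGen (R : Type v) where
  i : Fin 3
  j : Fin 3
  ne : i ≠ j
  s : R

/-- The generator `X_ij(s)` of the free `k`-Lie algebra. -/
noncomputable def freeX (k : Type u) {R : Type v} [CommRing k] (i j : Fin 3) (h : i ≠ j) (s : R) :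
    FreeLieAlgebra k (SlGen R) :=
  FreeLieAlgebra.of k ⟨i, j, h, s⟩

/-- The defining relators: linearity of `a ↦ X_ij(a)`; `[X_ij(a), X_jl(b)] = X_il(ab)` for distinct
`i, j, l`; `[X_ij(a), X_ij(b)] = 0`; and `[w, [X_ij(a), X_pq(b)]] = 0` for every generator `w`
whenever `i = p` or `j = q`. -/
inductive SlRelator (k : Type u) (R : Type v) [CommRing k] [Ring R] [Algebra k R] :
    FreeLieAlgebra k (SlGen R) → Prop
  | add (i j : Fin 3) (h : i ≠ j) (a b : R) :
      SlRelator k R (freeX k i j h (a + b) - (freeX k i j h a + freeX k i j h b))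
  | smul (i j : Fin 3) (h : i ≠ j) (c : k) (a : R) :
      SlRelator k R (freeX k i j h (c • a) - c • freeX k i j h a)
  | mul (i j l : Fin 3) (hij : i ≠ j) (hjl : j ≠ l) (hil : i ≠ l) (a b : R) :
      SlRelator k R (⁅freeX k i j hij a, freeX k j l hjl b⁆ - freeX k i l hil (a * b))
  | same (i j : Fin 3) (h : i ≠ j) (a b : R) :
      SlRelator k R ⁅freeX k i j h a, freeX k i j h b⁆
  | central (i j p q : Fin 3) (hij : i ≠ j) (hpq : p ≠ q) (h : i = p ∨ j = q) (a b : R)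
      (x y : Fin 3) (hxy : x ≠ y) (c : R) :
      SlRelator k R ⁅freeX k x y hxy c, ⁅freeX k i j hij a, freeX k p q hpq b⁆⁆

/-- The `k`-Lie algebra presented by the generators `X_ij(s)` and the relators above: the quotient
of the free Lie algebra by the Lie ideal generated by the relators. -/
abbrev SlPresented (k : Type u) (R : Type v) [CommRing k] [Ring R] [Algebra k R] :=
  FreeLieAlgebra k (SlGen R) ⧸
    LieSubmodule.lieSpan k (FreeLieAlgebra k (SlGen R)) {x | SlRelator k R x}

/-- The class of the generator `X_ij(s)` in the presented Lie algebra. -/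
noncomputable def presentedX (k : Type u) {R : Type v} [CommRing k] [Ring R] [Algebra k R]
    (i j : Fin 3) (h : i ≠ j) (s : R) : SlPresented k R :=
  LieSubmodule.Quotient.mk (freeX k i j h s)

/-! ### Lie algebras on universe lifts -/

section ULiftLie

variable {k : Type*} {L : Type*} [CommRing k] [LieRing L] [LieAlgebra k L]

/-! Centrality. Let T be the space of elements of the presented algebra that normalize every
`X_ij(R)` and have diagonal image. Brackets of generators are again generators up to sign or lie in
T, so T and the `X_ij(s)` together span everything (`presentedTorus_sup_span`). In a kernel element
t + s the root part s is determined by off-diagonal entries, so s = 0. Then [t, X_ij(c)] = X_ij(d)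
maps to 0, which forces d = 0, and t is central.

Universality. In a central extension of `sl_3(R)` a bracket depends only on the images of its
entries. So a E_ij has a canonical lift, the bracket of any lifts of a E_il and E_lj. The crux is
`lie_eq_lie_mul_one`: lifts of a E_ij and b E_jl have a bracket that depends only on ab. This gives
relation 2. Relation 4 is automatic, since its inner bracket lies over 0. The lift is unique because
each generator is itself a bracket of generators. -/

instance ULift.instLieRing : LieRing (ULift.{w} L) where
  bracket x y := ⟨⁅x.down, y.down⁆⟩
  add_lie _ _ _ := ULift.down_injective (add_lie _ _ _)
  lie_add _ _ _ := ULift.down_injective (lie_add _ _ _)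
  lie_self _ := ULift.down_injective (lie_self _)
  leibniz_lie _ _ _ := ULift.down_injective (leibniz_lie _ _ _)

instance ULift.instLieAlgebra : LieAlgebra k (ULift.{w} L) where
  lie_smul _ _ _ := ULift.down_injective (lie_smul _ _ _)

variable (k L) in
/-- A Lie algebra is isomorphic to its lift to a larger universe. -/
def LieEquiv.ulift : ULift.{w} L ≃ₗ⁅k⁆ L :=
  { (ULift.moduleEquiv : ULift.{w} L ≃ₗ[k] L) with
    map_lie' := rfl }

end ULiftLie

/-! ### Generalities on Lie algebras -/

section General

variable {k : Type*} {L : Type*} {M : Type*} {g : Type*} [CommRing k]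
  [LieRing L] [LieAlgebra k L] [LieRing M] [LieAlgebra k M] [LieRing g] [LieAlgebra k g]

/-- A homomorphism of Lie algebras that kills a set factors through the quotient by the ideal
generated by this set. -/
def LieHom.quotientLieSpanLift (s : Set L) (f : L →ₗ⁅k⁆ M) (hf : ∀ x ∈ s, f x = 0) :
    (L ⧸ LieSubmodule.lieSpan k L s) →ₗ⁅k⁆ M :=
  have h : LieSubmodule.lieSpan k L s ≤ f.ker :=
    LieSubmodule.lieSpan_le.mpr fun x hx => f.mem_ker.mpr (hf x hx)
  { (LieSubmodule.lieSpan k L s).toSubmodule.liftQ (f : L →ₗ[k] M) fun x hx => f.mem_ker.mp (h hx) with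
    map_lie' := by
      intro x y
      induction x using Submodule.Quotient.induction_on
      induction y using Submodule.Quotient.induction_on
      exact f.map_lie _ _ }

/-- A submodule that is stable under bracketing with a generating set and contains the generating
set is everything. -/
theorem LieSubalgebra.eq_top_of_lieSpan_eq_top {s : Set L} (hs : LieSubalgebra.lieSpan k L s = ⊤)
    (T : Submodule k L) (hsT : s ⊆ T) (hT : ∀ x ∈ s, ∀ y ∈ T, ⁅x, y⁆ ∈ T) : T = ⊤ := by
  -- The stabilizer of T is a subalgebra containing the generators, hence everything. So T is itself
  -- a subalgebra containing them.
  let N : LieSubalgebra k L :=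
    { carrier := {x | ∀ y ∈ T, ⁅x, y⁆ ∈ T}
      add_mem' := fun ha hb y hy => by rw [add_lie]; exact T.add_mem (ha y hy) (hb y hy)
      zero_mem' := fun y _ => by rw [zero_lie]; exact T.zero_mem
      smul_mem' := fun c a ha y hy => by rw [smul_lie]; exact T.smul_mem c (ha y hy)
      lie_mem' := fun {a b} ha hb y hy => by
        rw [lie_lie]
        exact T.sub_mem (ha _ (hb y hy)) (hb _ (ha y hy)) }
  have hN : ∀ x, x ∈ N := fun x => by
    have h : LieSubalgebra.lieSpan k L s ≤ N := LieSubalgebra.lieSpan_le.mpr hT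
    exact h (hs ▸ LieSubalgebra.mem_top x)
  let K : LieSubalgebra k L := { T with lie_mem' := fun {a b} _ hb => hN a b hb }
  have hK : LieSubalgebra.lieSpan k L s ≤ K := LieSubalgebra.lieSpan_le.mpr hsT
  exact eq_top_iff.mpr fun x _ => hK (hs ▸ LieSubalgebra.mem_top x)

/-- An element that commutes with a generating set is central. -/
theorem LieAlgebra.mem_center_of_lieSpan_eq_top {s : Set L}
    (hs : LieSubalgebra.lieSpan k L s = ⊤) (x : L) (hx : ∀ y ∈ s, ⁅x, y⁆ = 0) :
    x ∈ LieAlgebra.center k L := by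
  let N : LieSubalgebra k L :=
    { carrier := {y | ⁅x, y⁆ = 0}
      add_mem' := fun {a b} ha hb => by
        change ⁅x, a + b⁆ = 0; rw [lie_add, show ⁅x, a⁆ = 0 from ha, show ⁅x, b⁆ = 0 from hb, add_zero]
      zero_mem' := lie_zero x
      smul_mem' := fun c a ha => by change ⁅x, c • a⁆ = 0; rw [lie_smul, show ⁅x, a⁆ = 0 from ha, smul_zero]
      lie_mem' := fun {a b} ha hb => by
        change ⁅x, ⁅a, b⁆⁆ = 0
        rw [leibniz_lie, show ⁅x, a⁆ = 0 from ha, show ⁅x, b⁆ = 0 from hb, zero_lie, lie_zero,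
          add_zero] }
  have h : LieSubalgebra.lieSpan k L s ≤ N := LieSubalgebra.lieSpan_le.mpr hx
  refine (LieModule.mem_maxTrivSubmodule k L L x).mpr fun y => ?_
  rw [← lie_skew, show ⁅x, y⁆ = 0 from h (hs ▸ LieSubalgebra.mem_top y), neg_zero]

namespace IsCentralExtension

variable {p : M →ₗ⁅k⁆ g}

theorem lie_eq_zero_of_apply_eq_zero (hp : IsCentralExtension k p) {x : M}
    (hx : p x = 0) (y : M) : ⁅x, y⁆ = 0 := by
  have h := (LieModule.mem_maxTrivSubmodule k M M x).mp (hp.ker_le_center (p.mem_ker.mpr hx)) y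
  rw [← lie_skew, h, neg_zero]

/-- Changing an entry by a kernel element changes nothing, so lifts may be chosen freely inside
brackets. -/
theorem lie_congr (hp : IsCentralExtension k p) {x x' y y' : M} (hx : p x = p x')
    (hy : p y = p y') : ⁅x, y⁆ = ⁅x', y'⁆ := by
  have h₁ := hp.lie_eq_zero_of_apply_eq_zero (x := x - x') (by simp [hx]) y
  have h₂ := hp.lie_eq_zero_of_apply_eq_zero (x := y - y') (by simp [hy]) x'
  rw [sub_lie, sub_eq_zero] at h₁ h₂
  rw [h₁, ← lie_skew, h₂, lie_skew]

end IsCentralExtension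
end General

/-! ### The elements `s E_ij` of `sl_n(R)` -/

section SlAlg

variable (k : Type u) {R : Type v} [CommRing k] [Ring R] [Algebra k R] {n : ℕ}

/-- The element `s E_ij` of `sl_n(R)`. -/
def slE (i j : Fin n) (h : i ≠ j) (s : R) : slAlg k R n :=
  ⟨Matrix.single i j s, LieSubalgebra.subset_lieSpan ⟨i, j, s, h, rfl⟩⟩

@[simp]
theorem coe_slE (i j : Fin n) (h : i ≠ j) (s : R) :
    (slE k i j h s : Matrix (Fin n) (Fin n) R) = Matrix.single i j s := rfl

theorem slE_add (i j : Fin n) (h : i ≠ j) (a b : R) :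
    slE k i j h (a + b) = slE k i j h a + slE k i j h b :=
  Subtype.ext (Matrix.single_add i j a b)

theorem slE_smul (i j : Fin n) (h : i ≠ j) (c : k) (a : R) :
    slE k i j h (c • a) = c • slE k i j h a :=
  Subtype.ext (Matrix.smul_single c i j a).symm

theorem slE_lie_slE {i j l : Fin n} (hij : i ≠ j) (hjl : j ≠ l) (hil : i ≠ l) (a b : R) :
    ⁅slE k i j hij a, slE k j l hjl b⁆ = slE k i l hil (a * b) := by
  apply Subtype.ext
  rw [LieSubalgebra.coe_bracket, coe_slE, coe_slE, coe_slE, Ring.lie_def,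
    Matrix.single_mul_single_same, Matrix.single_mul_single_of_ne _ _ _ _ hil.symm, sub_zero]

theorem slE_lie_slE_of_ne {i j p q : Fin n} (hij : i ≠ j) (hpq : p ≠ q) (hjp : j ≠ p) (hqi : q ≠ i)
    (a b : R) : ⁅slE k i j hij a, slE k p q hpq b⁆ = 0 := by
  apply Subtype.ext
  rw [LieSubalgebra.coe_bracket, coe_slE, coe_slE, Ring.lie_def,
    Matrix.single_mul_single_of_ne _ _ _ _ hjp, Matrix.single_mul_single_of_ne _ _ _ _ hqi,
    sub_zero]
  rfl

theorem coe_slE_lie_slE_swap {i j : Fin n} (h : i ≠ j) (a b : R) :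
    (⁅slE k i j h a, slE k j i h.symm b⁆ : slAlg k R n).1 =
      Matrix.single i i (a * b) - Matrix.single j j (b * a) := by
  rw [LieSubalgebra.coe_bracket, coe_slE, coe_slE, Ring.lie_def, Matrix.single_mul_single_same,
    Matrix.single_mul_single_same]

end SlAlg

/-! ### Central extensions of `sl_n(R)` -/

namespace IsCentralExtension

variable {k : Type u} {R : Type v} [CommRing k] [Ring R] [Algebra k R] {n : ℕ}
  {M : Type*} [LieRing M] [LieAlgebra k M] {p : M →ₗ⁅k⁆ slAlg k R n}

/-- Replace y by [u, e] and apply Jacobi: [x, e] lies over [a E_ij, c E_il] = 0, so it is central.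
This moves b next to a, into an element with diagonal image. -/
theorem lie_eq_lie_lie (hp : IsCentralExtension k p) {i j l : Fin n} (hij : i ≠ j) (hjl : j ≠ l)
    (hil : i ≠ l) {a b c : R} {x y u e : M} (hx : p x = slE k i j hij a)
    (hy : p y = slE k j l hjl (b * c)) (hu : p u = slE k j i hij.symm b)
    (he : p e = slE k i l hil c) : ⁅x, y⁆ = ⁅⁅x, u⁆, e⁆ := by
  have h₁ : ⁅x, y⁆ = ⁅x, ⁅u, e⁆⁆ := hp.lie_congr rfl <| by
    rw [p.map_lie, hu, he, hy, slE_lie_slE]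
  have h₂ : ⁅⁅x, e⁆, u⁆ = 0 := hp.lie_eq_zero_of_apply_eq_zero (by
    rw [p.map_lie, hx, he, slE_lie_slE_of_ne k hij hil hij.symm hil.symm]) u
  rw [h₁, leibniz_lie, ← lie_skew u ⁅x, e⁆, h₂, neg_zero, add_zero]

/-- With e = [P, Q] through the index j, Jacobi gives [x, e] = -[Pc, Q] + [P, Qc]. The two terms
cancel, because moving c across leaves the same diagonal image c E_ii - c E_jj. -/
theorem lie_eq_zero_of_apply_eq_single (hp : IsCentralExtension k p) {i j l : Fin n} (hij : i ≠ j)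
    (hjl : j ≠ l) (hil : i ≠ l) {c : R} {x e : M}
    (hx : (p x : Matrix (Fin n) (Fin n) R) = Matrix.single j j c)
    (he : p e = slE k i l hil 1) : ⁅x, e⁆ = 0 := by
  obtain ⟨P, hP⟩ := hp.surjective (slE k i j hij (1 : R))
  obtain ⟨Pc, hPc⟩ := hp.surjective (slE k i j hij c)
  obtain ⟨Q, hQ⟩ := hp.surjective (slE k j l hjl (1 : R))
  obtain ⟨Qc, hQc⟩ := hp.surjective (slE k j l hjl c)
  obtain ⟨U, hU⟩ := hp.surjective (slE k j i hij.symm (1 : R))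
  obtain ⟨Uc, hUc⟩ := hp.surjective (slE k j i hij.symm c)
  have h₁ : ⁅x, e⁆ = ⁅x, ⁅P, Q⁆⁆ := hp.lie_congr rfl <| by
    rw [p.map_lie, he, hP, hQ, slE_lie_slE, mul_one]
  have h₂ : ⁅⁅x, P⁆, Q⁆ = ⁅-Pc, Q⁆ := hp.lie_congr (by
    rw [p.map_lie, map_neg, hP, hPc]
    apply Subtype.ext
    rw [LieSubalgebra.coe_bracket, hx, coe_slE, Ring.lie_def,
      Matrix.single_mul_single_of_ne _ _ _ _ hij.symm, Matrix.single_mul_single_same, one_mul,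
      zero_sub]
    rfl) rfl
  have h₃ : ⁅P, ⁅x, Q⁆⁆ = ⁅P, Qc⁆ := hp.lie_congr rfl (by
    rw [p.map_lie, hQ, hQc]
    apply Subtype.ext
    rw [LieSubalgebra.coe_bracket, hx, coe_slE, Ring.lie_def,
      Matrix.single_mul_single_of_ne _ _ _ _ hjl.symm, Matrix.single_mul_single_same, mul_one,
      sub_zero]
    rfl)
  have h₄ : ⁅P, Qc⁆ = ⁅Pc, Q⁆ := by
    rw [hp.lie_eq_lie_lie hij hjl hil hP (by rw [hQc, mul_one]) hUc he,
      hp.lie_eq_lie_lie hij hjl hil hPc (by rw [hQ, mul_one]) hU he]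
    refine hp.lie_congr ?_ rfl
    rw [p.map_lie, p.map_lie, hP, hUc, hPc, hU]
    apply Subtype.ext
    rw [coe_slE_lie_slE_swap, coe_slE_lie_slE_swap, one_mul, mul_one]
  rw [h₁, leibniz_lie, h₂, h₃, h₄, neg_lie, neg_add_cancel]

/-- In a central extension of `sl_n(R)`, the bracket of lifts of `a E_ij` and `b E_jl` depends
only on `a b`. -/
theorem lie_eq_lie_mul_one (hp : IsCentralExtension k p) {i j l : Fin n} (hij : i ≠ j)
    (hjl : j ≠ l) (hil : i ≠ l) {a b : R} {x y z t : M} (hx : p x = slE k i j hij a)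
    (hy : p y = slE k j l hjl b) (hz : p z = slE k i j hij (a * b))
    (ht : p t = slE k j l hjl 1) : ⁅x, y⁆ = ⁅z, t⁆ := by
  obtain ⟨e, he⟩ := hp.surjective (slE k i l hil (1 : R))
  obtain ⟨U, hU⟩ := hp.surjective (slE k j i hij.symm (1 : R))
  obtain ⟨V, hV⟩ := hp.surjective (slE k j i hij.symm b)
  rw [hp.lie_eq_lie_lie hij hjl hil hx (by rw [hy, mul_one]) hV he,
    hp.lie_eq_lie_lie hij hjl hil hz (by rw [ht, mul_one]) hU he, ← sub_eq_zero, ← sub_lie]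
  -- The diagonal images are ab E_ii - ba E_jj and ab E_ii - ab E_jj; they differ only at E_jj.
  refine hp.lie_eq_zero_of_apply_eq_single hij hjl hil (c := a * b - b * a) ?_ he
  rw [map_sub, p.map_lie, p.map_lie, hx, hV, hz, hU]
  change (⁅_, _⁆ : slAlg k R n).1 - (⁅_, _⁆ : slAlg k R n).1 = _
  rw [coe_slE_lie_slE_swap, coe_slE_lie_slE_swap, mul_one, one_mul, sub_sub_sub_cancel_left]
  rw [sub_eq_iff_eq_add, ← Matrix.single_add, sub_add_cancel]

/-- In a central extension of `sl_n(R)` with `n ≥ 3`, lifts of `a E_ij` and `b E_ij` commute. -/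
theorem lie_eq_zero_of_same (hp : IsCentralExtension k p) {i j l : Fin n} (hij : i ≠ j)
    (hjl : j ≠ l) (hil : i ≠ l) {a b : R} {x y : M} (hx : p x = slE k i j hij a)
    (hy : p y = slE k i j hij b) : ⁅x, y⁆ = 0 := by
  obtain ⟨u, hu⟩ := hp.surjective (slE k i l hil b)
  obtain ⟨t, ht⟩ := hp.surjective (slE k l j hjl.symm (1 : R))
  have h₁ : ⁅x, y⁆ = ⁅x, ⁅u, t⁆⁆ := hp.lie_congr rfl <| by
    rw [p.map_lie, hu, ht, hy, slE_lie_slE, mul_one]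
  -- Both [x, u] and [x, t] lie over 0, so both Jacobi terms of [x, [u, t]] vanish.
  have h₂ : ⁅⁅x, u⁆, t⁆ = 0 := hp.lie_eq_zero_of_apply_eq_zero (by
    rw [p.map_lie, hx, hu, slE_lie_slE_of_ne k hij hil hij.symm hil.symm]) t
  have h₃ : ⁅⁅x, t⁆, u⁆ = 0 := hp.lie_eq_zero_of_apply_eq_zero (by
    rw [p.map_lie, hx, ht, slE_lie_slE_of_ne k hij hjl.symm hjl hij.symm]) u
  rw [h₁, leibniz_lie, h₂, ← lie_skew u, h₃, neg_zero, add_zero]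

end IsCentralExtension

/-! ### The presented Lie algebra -/

section Presented

variable {k : Type u} {R : Type v} [CommRing k] [Ring R] [Algebra k R]

/-- The index in `{0, 1, 2}` that differs from two given distinct ones. -/
def thirdIndex (i j : Fin 3) : Fin 3 := -(i + j)

/-- The three indices sum to 0 modulo 3, whence the formula for the third. -/
theorem ne_thirdIndex : ∀ {i j : Fin 3}, i ≠ j → i ≠ thirdIndex i j := by decide

theorem thirdIndex_ne : ∀ {i j : Fin 3}, i ≠ j → thirdIndex i j ≠ j := by decide

theorem eq_thirdIndex : ∀ {i j l : Fin 3}, i ≠ j → j ≠ l → i ≠ l → j = thirdIndex i l := by decide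

theorem mk_eq_of_slRelator {x y : FreeLieAlgebra k (SlGen R)} (h : SlRelator k R (x - y)) :
    (LieSubmodule.Quotient.mk x : SlPresented k R) = LieSubmodule.Quotient.mk y :=
  (Submodule.Quotient.eq _).mpr (LieSubmodule.subset_lieSpan h)

theorem mk_eq_zero_of_slRelator {x : FreeLieAlgebra k (SlGen R)} (h : SlRelator k R x) :
    (LieSubmodule.Quotient.mk x : SlPresented k R) = 0 :=
  LieSubmodule.Quotient.mk_eq_zero'.mpr (LieSubmodule.subset_lieSpan h)

theorem presentedX_add (i j : Fin 3) (h : i ≠ j) (a b : R) :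
    presentedX k i j h (a + b) = presentedX k i j h a + presentedX k i j h b :=
  mk_eq_of_slRelator (.add i j h a b)

theorem presentedX_smul (i j : Fin 3) (h : i ≠ j) (c : k) (a : R) :
    presentedX k i j h (c • a) = c • presentedX k i j h a :=
  mk_eq_of_slRelator (.smul i j h c a)

theorem presentedX_lie {i j l : Fin 3} (hij : i ≠ j) (hjl : j ≠ l) (hil : i ≠ l) (a b : R) :
    ⁅presentedX k i j hij a, presentedX k j l hjl b⁆ = presentedX k i l hil (a * b) :=
  mk_eq_of_slRelator (.mul i j l hij hjl hil a b)

theorem presentedX_lie_lie (i j p q : Fin 3) (hij : i ≠ j) (hpq : p ≠ q) (h : i = p ∨ j = q)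
    (a b : R) (x y : Fin 3) (hxy : x ≠ y) (c : R) :
    ⁅presentedX k x y hxy c, ⁅presentedX k i j hij a, presentedX k p q hpq b⁆⁆ = 0 :=
  mk_eq_zero_of_slRelator (.central i j p q hij hpq h a b x y hxy c)

variable (k R) in
/-- The linear map `a ↦ X_ij(a)`. -/
noncomputable def presentedXLinear (i j : Fin 3) (h : i ≠ j) : R →ₗ[k] SlPresented k R where
  toFun := presentedX k i j h
  map_add' := presentedX_add i j h
  map_smul' := presentedX_smul i j h

theorem presentedX_neg (i j : Fin 3) (h : i ≠ j) (a : R) :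
    presentedX k i j h (-a) = -presentedX k i j h a :=
  map_neg (presentedXLinear k R i j h) a

theorem presentedX_zero (i j : Fin 3) (h : i ≠ j) : presentedX k i j h (0 : R) = 0 :=
  map_zero (presentedXLinear k R i j h)

variable (k R) in
/-- The set of all generators `X_ij(s)`. -/
def presentedGens : Set (SlPresented k R) :=
  {x | ∃ (i j : Fin 3) (h : i ≠ j) (s : R), x = presentedX k i j h s}

variable (k R) in
/-- The quotient map from the free Lie algebra to the presented one. -/
noncomputable def presentedMk : FreeLieAlgebra k (SlGen R) →ₗ⁅k⁆ SlPresented k R :=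
  { (LieSubmodule.lieSpan k (FreeLieAlgebra k (SlGen R))
      {x | SlRelator k R x}).toSubmodule.mkQ with
    map_lie' := rfl }

section Lift

variable {M : Type*} [LieRing M] [LieAlgebra k M]

variable (k) in
/-- A family of elements of a Lie algebra that satisfies the defining relations of the presented
Lie algebra. -/
structure SatisfiesSlRelations (Y : ∀ i j : Fin 3, i ≠ j → R → M) : Prop where
  add (i j : Fin 3) (h : i ≠ j) (a b : R) : Y i j h (a + b) = Y i j h a + Y i j h b
  smul (i j : Fin 3) (h : i ≠ j) (c : k) (a : R) : Y i j h (c • a) = c • Y i j h a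
  mul (i j l : Fin 3) (hij : i ≠ j) (hjl : j ≠ l) (hil : i ≠ l) (a b : R) :
    ⁅Y i j hij a, Y j l hjl b⁆ = Y i l hil (a * b)
  same (i j : Fin 3) (h : i ≠ j) (a b : R) : ⁅Y i j h a, Y i j h b⁆ = 0
  central (i j p q : Fin 3) (hij : i ≠ j) (hpq : p ≠ q) (h : i = p ∨ j = q) (a b : R)
    (x y : Fin 3) (hxy : x ≠ y) (c : R) : ⁅Y x y hxy c, ⁅Y i j hij a, Y p q hpq b⁆⁆ = 0

theorem SatisfiesSlRelations.lift_eq_zero {Y : ∀ i j : Fin 3, i ≠ j → R → M}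
    (hY : SatisfiesSlRelations k Y) (x : FreeLieAlgebra k (SlGen R)) (hx : SlRelator k R x) :
    FreeLieAlgebra.lift k (fun x : SlGen R => Y x.i x.j x.ne x.s) x = 0 := by
  have hof (i j : Fin 3) (h : i ≠ j) (s : R) :
      FreeLieAlgebra.lift k (fun x : SlGen R => Y x.i x.j x.ne x.s) (freeX k i j h s) =
        Y i j h s := FreeLieAlgebra.lift_of_apply _ _
  cases hx with
  | add i j h a b => rw [map_sub, map_add, hof, hof, hof, hY.add, sub_self]
  | smul i j h c a => rw [map_sub, map_smul, hof, hof, hY.smul, sub_self]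
  | mul i j l hij hjl hil a b =>
    rw [map_sub, LieHom.map_lie, hof, hof, hof, hY.mul i j l hij hjl hil, sub_self]
  | same i j h a b => rw [LieHom.map_lie, hof, hof, hY.same]
  | central i j p q hij hpq h a b x y hxy c =>
    rw [LieHom.map_lie, LieHom.map_lie, hof, hof, hof, hY.central _ _ _ _ _ _ h]

/-- The homomorphism from the presented Lie algebra given by the images of the generators. -/
noncomputable def presentedLift (Y : ∀ i j : Fin 3, i ≠ j → R → M)
    (hY : SatisfiesSlRelations k Y) : SlPresented k R →ₗ⁅k⁆ M :=
  (FreeLieAlgebra.lift k fun x : SlGen R => Y x.i x.j x.ne x.s).quotientLieSpanLift _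
    hY.lift_eq_zero

@[simp]
theorem presentedLift_presentedX (Y : ∀ i j : Fin 3, i ≠ j → R → M)
    (hY : SatisfiesSlRelations k Y) (i j : Fin 3) (h : i ≠ j) (s : R) :
    presentedLift Y hY (presentedX k i j h s) = Y i j h s :=
  FreeLieAlgebra.lift_of_apply (fun x : SlGen R => Y x.i x.j x.ne x.s) ⟨i, j, h, s⟩

theorem presented_hom_ext {f g : SlPresented k R →ₗ⁅k⁆ M}
    (h : ∀ (i j : Fin 3) (h : i ≠ j) (s : R),
      f (presentedX k i j h s) = g (presentedX k i j h s)) : f = g := by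
  have hq : f.comp (presentedMk k R) = g.comp (presentedMk k R) :=
    FreeLieAlgebra.hom_ext fun x => h x.i x.j x.ne x.s
  ext x
  induction x using Submodule.Quotient.induction_on with
  | H x => exact LieHom.congr_fun hq x

end Lift

variable (k R) in
-- The quotient map factors through the span, because it does so on free generators.
theorem lieSpan_presentedGens : LieSubalgebra.lieSpan k _ (presentedGens k R) = ⊤ := by
  let S := LieSubalgebra.lieSpan k _ (presentedGens k R)
  let Y : SlGen R → S := fun x =>
    ⟨presentedX k x.i x.j x.ne x.s, LieSubalgebra.subset_lieSpan ⟨x.i, x.j, x.ne, x.s, rfl⟩⟩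
  have hq : S.incl.comp (FreeLieAlgebra.lift k Y) = presentedMk k R :=
    FreeLieAlgebra.hom_ext fun x => by
      rw [LieHom.comp_apply, FreeLieAlgebra.lift_of_apply]
      rfl
  refine eq_top_iff.mpr fun x _ => ?_
  induction x using Submodule.Quotient.induction_on with
  | H x =>
    have h : ((FreeLieAlgebra.lift k Y x : S) : SlPresented k R) = presentedMk k R x :=
      LieHom.congr_fun hq x
    have h' := (FreeLieAlgebra.lift k Y x).2
    rw [h] at h'
    exact h'

end Presented

/-! ### The projection to `sl_3(R)` -/

section Projection

variable (k : Type u) (R : Type v) [CommRing k] [Ring R] [Algebra k R]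

variable {k R} in
theorem slE_lie_eq_zero {i j p q : Fin 3} (hij : i ≠ j) (hpq : p ≠ q) (h : i = p ∨ j = q)
    (a b : R) : ⁅slE k i j hij a, slE k p q hpq b⁆ = 0 := by
  rcases h with rfl | rfl
  · exact slE_lie_slE_of_ne k hij hpq hij.symm hpq.symm a b
  · exact slE_lie_slE_of_ne k hij hpq hpq.symm hij.symm a b

theorem satisfiesSlRelations_slE : SatisfiesSlRelations k (slE k (R := R) (n := 3)) where
  add := slE_add k
  smul := slE_smul k
  mul _ _ _ := slE_lie_slE k
  same _ _ h := slE_lie_eq_zero h h (.inl rfl)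
  central _ _ _ _ hij hpq h a b _ _ _ _ := by rw [slE_lie_eq_zero hij hpq h, lie_zero]

/-- The homomorphism from the presented Lie algebra to `sl_3(R)` with `X_ij(s) ↦ s E_ij`. -/
noncomputable def presentedProj : SlPresented k R →ₗ⁅k⁆ slAlg k R 3 :=
  presentedLift _ (satisfiesSlRelations_slE k R)

@[simp]
theorem presentedProj_presentedX (i j : Fin 3) (h : i ≠ j) (s : R) :
    presentedProj k R (presentedX k i j h s) = slE k i j h s :=
  presentedLift_presentedX _ _ i j h s

theorem presentedProj_surjective : Function.Surjective (presentedProj k R) := by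
  have h : slAlg k R 3 ≤ ((slAlg k R 3).incl.comp (presentedProj k R)).range := by
    refine LieSubalgebra.lieSpan_le.mpr ?_
    rintro _ ⟨i, j, s, h, rfl⟩
    exact ⟨presentedX k i j h s, congrArg Subtype.val (presentedProj_presentedX k R i j h s)⟩
  intro y
  obtain ⟨x, hx⟩ := h y.2
  exact ⟨x, Subtype.ext hx⟩

/-- The elements that normalize every subspace `X_ij(R)` and have diagonal image in `sl_3(R)`. -/
def presentedTorus : Submodule k (SlPresented k R) where
  carrier := {x | (∀ (i j : Fin 3) (h : i ≠ j) (c : R),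
      ∃ d : R, ⁅x, presentedX k i j h c⁆ = presentedX k i j h d) ∧
    ∀ i j : Fin 3, i ≠ j → (presentedProj k R x : Matrix (Fin 3) (Fin 3) R) i j = 0}
  add_mem' {x y} hx hy := by
    refine ⟨fun i j h c => ?_, fun i j h => ?_⟩
    · obtain ⟨d, hd⟩ := hx.1 i j h c
      obtain ⟨e, he⟩ := hy.1 i j h c
      exact ⟨d + e, by rw [add_lie, hd, he, presentedX_add]⟩
    · rw [map_add]
      change (presentedProj k R x).1 i j + (presentedProj k R y).1 i j = 0
      rw [hx.2 i j h, hy.2 i j h, add_zero]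
  zero_mem' := by
    refine ⟨fun i j h c => ⟨0, by rw [zero_lie, presentedX_zero]⟩, fun i j h => ?_⟩
    rw [map_zero]
    rfl
  smul_mem' t x hx := by
    refine ⟨fun i j h c => ?_, fun i j h => ?_⟩
    · obtain ⟨d, hd⟩ := hx.1 i j h c
      exact ⟨t • d, by rw [smul_lie, hd, presentedX_smul]⟩
    · rw [map_smul]
      change t • (presentedProj k R x).1 i j = 0
      rw [hx.2 i j h, smul_zero]

variable {k R}

/-- Relation 4 makes such a bracket commute with all generators, and its image is 0. -/
theorem mem_presentedTorus_of_same {i j p q : Fin 3} (hij : i ≠ j) (hpq : p ≠ q)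
    (h : i = p ∨ j = q) (a b : R) :
    ⁅presentedX k i j hij a, presentedX k p q hpq b⁆ ∈ presentedTorus k R := by
  refine ⟨fun x y hxy c => ⟨0, ?_⟩, fun x y _ => ?_⟩
  · rw [← lie_skew, presentedX_lie_lie _ _ _ _ hij hpq h, neg_zero, presentedX_zero]
  · rw [LieHom.map_lie, presentedProj_presentedX, presentedProj_presentedX,
      slE_lie_eq_zero hij hpq h]
    rfl

/-- In the Jacobi expansion the term containing [X_ij(a), X_im(c)] dies by relation 4. -/
theorem presentedX_lie_swap_lie {i j m : Fin 3} (hij : i ≠ j) (him : i ≠ m) (hjm : j ≠ m)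
    (a b c : R) :
    ⁅⁅presentedX k i j hij a, presentedX k j i hij.symm b⁆, presentedX k i m him c⁆ =
      presentedX k i m him (a * (b * c)) := by
  have h : ⁅⁅presentedX k i j hij a, presentedX k i m him c⁆, presentedX k j i hij.symm b⁆ = 0 := by
    rw [← lie_skew, presentedX_lie_lie _ _ _ _ hij him (.inl rfl), neg_zero]
  rw [lie_lie, presentedX_lie hij.symm him hjm, presentedX_lie hij hjm him,
    ← lie_skew (presentedX k j i _ b), h, neg_zero, sub_zero]

theorem presentedX_lie_swap_lie' {i j m : Fin 3} (hij : i ≠ j) (hmi : m ≠ i) (hmj : m ≠ j)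
    (a b c : R) :
    ⁅⁅presentedX k i j hij a, presentedX k j i hij.symm b⁆, presentedX k m i hmi c⁆ =
      presentedX k m i hmi (-(c * a * b)) := by
  have h : ⁅⁅presentedX k j i hij.symm b, presentedX k m i hmi c⁆, presentedX k i j hij a⁆ = 0 := by
    rw [← lie_skew, presentedX_lie_lie _ _ _ _ hij.symm hmi (.inr rfl), neg_zero]
  rw [lie_lie, ← lie_skew (presentedX k i j hij a) ⁅_, _⁆, h, neg_zero, zero_sub,
    ← lie_skew (presentedX k i j hij a), presentedX_lie hmi hij hmj, lie_neg, neg_neg, ← lie_skew,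
    presentedX_lie hmj hij.symm hmi, presentedX_neg]

theorem eq_of_ne_of_ne : ∀ {i j p q : Fin 3}, i ≠ j → p ≠ q → i ≠ p ∧ j ≠ q → j ≠ p → q = i := by
  decide

/-- The condition says that exactly one of x, y lies in {i, j}. If it fails, both do, and the third
index lies outside, so each half of the detour satisfies it. -/
theorem thirdIndex_crosses : ∀ {i j x y : Fin 3}, i ≠ j → x ≠ y →
    ¬(((x = i ∨ x = j) → (y ≠ i ∧ y ≠ j)) ∧ ((x ≠ i ∧ x ≠ j) → (y = i ∨ y = j))) →
    (((x = i ∨ x = j) → (thirdIndex x y ≠ i ∧ thirdIndex x y ≠ j)) ∧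
      ((x ≠ i ∧ x ≠ j) → (thirdIndex x y = i ∨ thirdIndex x y = j))) ∧
    (((thirdIndex x y = i ∨ thirdIndex x y = j) → (y ≠ i ∧ y ≠ j)) ∧
      ((thirdIndex x y ≠ i ∧ thirdIndex x y ≠ j) → (y = i ∨ y = j))) := by
  decide

theorem mem_presentedTorus_of_swap {i j : Fin 3} (hij : i ≠ j) (a b : R) :
    ⁅presentedX k i j hij a, presentedX k j i hij.symm b⁆ ∈ presentedTorus k R := by
  have hl {i j m : Fin 3} (hij : i ≠ j) (him : i ≠ m) (hjm : j ≠ m) (a b c : R) : ∃ d,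
      ⁅⁅presentedX k i j hij a, presentedX k j i hij.symm b⁆, presentedX k i m him c⁆ =
        presentedX k i m him d := ⟨_, presentedX_lie_swap_lie hij him hjm a b c⟩
  have hr {i j m : Fin 3} (hij : i ≠ j) (hmi : m ≠ i) (hmj : m ≠ j) (a b c : R) : ∃ d,
      ⁅⁅presentedX k i j hij a, presentedX k j i hij.symm b⁆, presentedX k m i hmi c⁆ =
        presentedX k m i hmi d := ⟨_, presentedX_lie_swap_lie' hij hmi hmj a b c⟩
  have hneg {x y : Fin 3} (hxy : x ≠ y) (c : R)
      (h : ∃ d, ⁅⁅presentedX k j i hij.symm b, presentedX k i j hij a⁆, presentedX k x y hxy c⁆ =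
        presentedX k x y hxy d) :
      ∃ d, ⁅⁅presentedX k i j hij a, presentedX k j i hij.symm b⁆, presentedX k x y hxy c⁆ =
        presentedX k x y hxy d := by
    obtain ⟨d, hd⟩ := h
    exact ⟨-d, by rw [← lie_skew (presentedX k i j hij a), neg_lie, hd, presentedX_neg]⟩
  have hthird {x y : Fin 3} (hxy : x ≠ y) (h : (x = i ∨ x = j) → (y ≠ i ∧ y ≠ j))
      (h' : (x ≠ i ∧ x ≠ j) → (y = i ∨ y = j)) (c : R) :
      ∃ d, ⁅⁅presentedX k i j hij a, presentedX k j i hij.symm b⁆, presentedX k x y hxy c⁆ =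
        presentedX k x y hxy d := by
    by_cases hxi : x = i
    · subst hxi
      exact hl hij hxy (h (.inl rfl)).2.symm a b c
    by_cases hxj : x = j
    · subst hxj
      exact hneg hxy c (hl hij.symm hxy (h (.inr rfl)).1.symm b a c)
    rcases h' ⟨hxi, hxj⟩ with rfl | rfl
    · exact hr hij hxy hxj a b c
    · exact hneg hxy c (hr hij.symm hxy hxi b a c)
  refine ⟨fun x y hxy c => ?_, fun x y hxy => ?_⟩
  · by_cases hdone : ((x = i ∨ x = j) → (y ≠ i ∧ y ≠ j)) ∧ ((x ≠ i ∧ x ≠ j) → (y = i ∨ y = j))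
    · exact hthird hxy hdone.1 hdone.2 c
    · obtain ⟨hm₁, hm₂⟩ := thirdIndex_crosses hij hxy hdone
      have hx := ne_thirdIndex hxy
      have hy := thirdIndex_ne hxy
      obtain ⟨d, hd⟩ := hthird hx hm₁.1 hm₁.2 c
      obtain ⟨e, he⟩ := hthird hy hm₂.1 hm₂.2 1
      -- For X_ij and X_ji themselves, write X_xy(c) = [X_xm(c), X_my(1)] with m the third index and
      -- let the bracket act as a derivation.
      refine ⟨d * 1 + c * e, ?_⟩
      conv_lhs => rw [← mul_one c, ← presentedX_lie hx hy hxy, leibniz_lie, hd, he]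
      rw [presentedX_lie hx hy hxy, presentedX_lie hx hy hxy, presentedX_add]
  · rw [LieHom.map_lie, presentedProj_presentedX, presentedProj_presentedX, coe_slE_lie_slE_swap]
    rw [Matrix.sub_apply, Matrix.single_apply_of_ne _ _ _ _ _ (by grind),
      Matrix.single_apply_of_ne _ _ _ _ _ (by grind), sub_zero]

variable (k R)

theorem presentedTorus_sup_span :
    presentedTorus k R ⊔ Submodule.span k (presentedGens k R) = ⊤ := by
  refine LieSubalgebra.eq_top_of_lieSpan_eq_top (lieSpan_presentedGens k R) _
    (fun x hx => Submodule.mem_sup_right (Submodule.subset_span hx)) ?_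
  rintro _ ⟨i, j, hij, a, rfl⟩ y hy
  obtain ⟨t, ht, s, hs, rfl⟩ := Submodule.mem_sup.mp hy
  rw [lie_add]
  refine Submodule.add_mem _ ?_ ?_
  · obtain ⟨d, hd⟩ := ht.1 i j hij a
    rw [← lie_skew, hd, ← presentedX_neg]
    exact Submodule.mem_sup_right (Submodule.subset_span ⟨i, j, hij, _, rfl⟩)
  · clear hy
    induction hs using Submodule.span_induction with
    | zero => rw [lie_zero]; exact Submodule.zero_mem _
    | add x y _ _ hx hy =>
      rw [lie_add]
      exact Submodule.add_mem _ hx hy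
    | smul c x _ hx => rw [lie_smul]; exact Submodule.smul_mem _ c hx
    | mem x hx =>
      obtain ⟨p, q, hpq, b, rfl⟩ := hx
      by_cases h : i = p ∨ j = q
      · exact Submodule.mem_sup_left (mem_presentedTorus_of_same hij hpq h a b)
      rw [not_or] at h
      by_cases hjp : j = p
      · subst hjp
        by_cases hiq : i = q
        · subst hiq
          exact Submodule.mem_sup_left (mem_presentedTorus_of_swap hij a b)
        · rw [presentedX_lie hij hpq hiq]
          exact Submodule.mem_sup_right (Submodule.subset_span ⟨_, _, _, _, rfl⟩)
      · have hiq : q = i := eq_of_ne_of_ne hij hpq h hjp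
        subst hiq
        rw [← lie_skew, presentedX_lie hpq hij (Ne.symm hjp), ← presentedX_neg]
        exact Submodule.mem_sup_right (Submodule.subset_span ⟨_, _, _, _, rfl⟩)

variable {k R} in
-- The projection is thus injective on the span of the generators: off-diagonal entries recover the
-- element.
theorem eq_sum_of_mem_span_presentedGens {x : SlPresented k R}
    (hx : x ∈ Submodule.span k (presentedGens k R)) :
    x = ∑ q : {q : Fin 3 × Fin 3 // q.1 ≠ q.2},
      presentedX k q.1.1 q.1.2 q.2
        ((presentedProj k R x : Matrix (Fin 3) (Fin 3) R) q.1.1 q.1.2) := by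
  induction hx using Submodule.span_induction with
  | zero =>
    rw [map_zero]
    exact (Finset.sum_eq_zero fun q _ => presentedX_zero _ _ _).symm
  | add x y _ _ hx hy =>
    conv_lhs => rw [hx, hy]
    rw [← Finset.sum_add_distrib, map_add]
    exact Finset.sum_congr rfl fun q _ => (presentedX_add _ _ _ _ _).symm
  | smul c x _ hx =>
    conv_lhs => rw [hx]
    rw [Finset.smul_sum, map_smul]
    exact Finset.sum_congr rfl fun q _ => (presentedX_smul _ _ _ _ _).symm
  | mem x hx =>
    obtain ⟨i, j, h, b, rfl⟩ := hx
    rw [presentedProj_presentedX, coe_slE, Finset.sum_eq_single ⟨(i, j), h⟩,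
      Matrix.single_apply_same]
    · rintro ⟨⟨p, q⟩, hpq⟩ _ hne
      rw [Matrix.single_apply_of_ne, presentedX_zero]
      rintro ⟨rfl, rfl⟩
      exact hne rfl
    · exact fun h => (h (Finset.mem_univ _)).elim

theorem isCentralExtension_presentedProj : IsCentralExtension k (presentedProj k R) where
  surjective := presentedProj_surjective k R
  ker_le_center := by
    intro x hx
    rw [LieHom.mem_ker] at hx
    have hx' : x ∈ presentedTorus k R ⊔ Submodule.span k (presentedGens k R) := by
      rw [presentedTorus_sup_span]; trivial
    obtain ⟨t, ht, s, hs, rfl⟩ := Submodule.mem_sup.mp hx'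
    have hs0 : s = 0 := by
      rw [eq_sum_of_mem_span_presentedGens hs]
      refine Finset.sum_eq_zero fun q _ => ?_
      have h : (presentedProj k R s).1 q.1.1 q.1.2 = 0 := by
        have h₁ : presentedProj k R s = -presentedProj k R t := by
          rw [map_add] at hx
          exact eq_neg_of_add_eq_zero_right hx
        rw [h₁]
        change -(presentedProj k R t).1 q.1.1 q.1.2 = 0
        rw [ht.2 _ _ q.2, neg_zero]
      rw [h, presentedX_zero]
    rw [hs0, add_zero] at hx ⊢
    refine LieAlgebra.mem_center_of_lieSpan_eq_top (lieSpan_presentedGens k R) t ?_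
    rintro _ ⟨i, j, h, c, rfl⟩
    obtain ⟨d, hd⟩ := ht.1 i j h c
    -- The image of t is 0, so X_ij(d) = [t, X_ij(c)] maps to 0.
    have hd0 : slE k i j h d = 0 := by
      rw [← presentedProj_presentedX, ← hd, LieHom.map_lie, hx, zero_lie]
    have hd0' : d = 0 := by
      have := congrFun (congrFun (congrArg Subtype.val hd0) i) j
      rw [coe_slE, Matrix.single_apply_same] at this
      exact this
    rw [hd, hd0', presentedX_zero]

end Projection

/-! ### The universal property -/

section Universal

variable {k : Type u} {R : Type v} [CommRing k] [Ring R] [Algebra k R]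

namespace IsCentralExtension

variable {M : Type*} [LieRing M] [LieAlgebra k M] {p : M →ₗ⁅k⁆ slAlg k R 3}

/-- The canonical lift of `a E_ij` to a central extension of `sl_3(R)`: the bracket of arbitrary
lifts of `a E_il` and `E_lj`, where `l` is the third index. -/
noncomputable def slLift (hp : IsCentralExtension k p) (i j : Fin 3) (h : i ≠ j) (a : R) : M :=
  ⁅Function.surjInv hp.surjective (slE k i (thirdIndex i j) (ne_thirdIndex h) a),
    Function.surjInv hp.surjective (slE k (thirdIndex i j) j (thirdIndex_ne h) 1)⁆

/-- Independence of all choices; it yields both relation 2 and uniqueness of the lift. -/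
theorem slLift_eq_lie (hp : IsCentralExtension k p) {i j l : Fin 3} (hij : i ≠ j)
    (hjl : j ≠ l) (hil : i ≠ l) {a b : R} {x y : M} (hx : p x = slE k i j hij a)
    (hy : p y = slE k j l hjl b) : hp.slLift i l hil (a * b) = ⁅x, y⁆ := by
  obtain rfl := eq_thirdIndex hij hjl hil
  exact (hp.lie_eq_lie_mul_one hij hjl hil hx hy (Function.surjInv_eq hp.surjective _)
    (Function.surjInv_eq hp.surjective _)).symm

theorem apply_slLift (hp : IsCentralExtension k p) (i j : Fin 3) (h : i ≠ j) (a : R) :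
    p (hp.slLift i j h a) = slE k i j h a := by
  rw [slLift, p.map_lie, Function.surjInv_eq hp.surjective, Function.surjInv_eq hp.surjective, slE_lie_slE, mul_one]

theorem satisfiesSlRelations_slLift (hp : IsCentralExtension k p) :
    SatisfiesSlRelations k hp.slLift where
  add i j h a b := by
    rw [slLift, slLift, slLift, ← add_lie]
    refine hp.lie_congr ?_ rfl
    rw [map_add, Function.surjInv_eq hp.surjective, Function.surjInv_eq hp.surjective, Function.surjInv_eq hp.surjective, slE_add]
  smul i j h c a := by
    rw [slLift, slLift, ← smul_lie]
    refine hp.lie_congr ?_ rfl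
    rw [map_smul, Function.surjInv_eq hp.surjective, Function.surjInv_eq hp.surjective, slE_smul]
  mul i j l hij hjl hil a b :=
    (hp.slLift_eq_lie hij hjl hil (hp.apply_slLift i j hij a) (hp.apply_slLift j l hjl b)).symm
  same i j h a b := hp.lie_eq_zero_of_same h (thirdIndex_ne h).symm (ne_thirdIndex h)
    (hp.apply_slLift i j h a) (hp.apply_slLift i j h b)
  central i j q r hij hqr h a b x y hxy c := by
    rw [← lie_skew, hp.lie_eq_zero_of_apply_eq_zero, neg_zero]
    rw [p.map_lie, apply_slLift, apply_slLift, slE_lie_eq_zero hij hqr h]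

end IsCentralExtension

variable (k R)

theorem isUniversalCentralExtension_presentedProj :
    IsUniversalCentralExtension.{w} k (presentedProj k R) where
  isCentralExtension := isCentralExtension_presentedProj k R
  existsUnique_lift M _ _ p hp := by
    refine ⟨presentedLift _ hp.satisfiesSlRelations_slLift, ?_, fun h hh => ?_⟩
    · refine presented_hom_ext fun i j h s => ?_
      rw [LieHom.comp_apply, presentedLift_presentedX, hp.apply_slLift, presentedProj_presentedX]
    · have hph (i j : Fin 3) (hij : i ≠ j) (s : R) :
          p (h (presentedX k i j hij s)) = slE k i j hij s := by
        rw [← presentedProj_presentedX, ← hh, LieHom.comp_apply]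
      refine presented_hom_ext fun i j hij s => ?_
      have hl := ne_thirdIndex hij
      have hr := thirdIndex_ne hij
      -- Since X_ij(s) = [X_il(s), X_lj(1)], its image is a bracket of lifts, hence the canonical
      -- lift.
      rw [presentedLift_presentedX, ← mul_one s,
        hp.slLift_eq_lie hl hr hij (hph _ _ hl s) (hph _ _ hr 1), ← h.map_lie,
        presentedX_lie hl hr hij]

end Universal

/-! ### Comparison of universal central extensions across universes -/

section Uniqueness

variable {k : Type*} {g : Type*} [CommRing k] [LieRing g] [LieAlgebra k g]

theorem IsCentralExtension.comp_lieEquiv {L L' : Type*} [LieRing L] [LieAlgebra k L] [LieRing L']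
    [LieAlgebra k L'] {f : L →ₗ⁅k⁆ g} (hf : IsCentralExtension k f) (e : L' ≃ₗ⁅k⁆ L) :
    IsCentralExtension k (f.comp e.toLieHom) where
  surjective := hf.surjective.comp e.surjective
  ker_le_center x hx := by
    refine (LieModule.mem_maxTrivSubmodule k L' L' x).mpr fun y => e.injective ?_
    have h := (LieModule.mem_maxTrivSubmodule k L L (e x)).mp
      (hf.ker_le_center (f.mem_ker.mpr (LieHom.mem_ker.mp hx))) (e y)
    exact (e.toLieHom.map_lie y x).trans (h.trans (map_zero e.toLieHom).symm)

/-- A universal central extension has the universal property with respect to central extensions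
in every smaller universe. -/
theorem IsUniversalCentralExtension.existsUnique_lift_of_ulift {L : Type*} [LieRing L]
    [LieAlgebra k L] {f : L →ₗ⁅k⁆ g} (hf : IsUniversalCentralExtension.{max w w'} k f)
    (M : Type w) [LieRing M] [LieAlgebra k M] (p : M →ₗ⁅k⁆ g) (hp : IsCentralExtension k p) :
    ∃! h : L →ₗ⁅k⁆ M, p.comp h = f := by
  let e : ULift.{w'} M ≃ₗ⁅k⁆ M := LieEquiv.ulift k M
  obtain ⟨h, hh, huniq⟩ := hf.existsUnique_lift (ULift.{w'} M) _ (hp.comp_lieEquiv e)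
  refine ⟨e.toLieHom.comp h, hh, fun h' hh' => ?_⟩
  have := huniq (e.symm.toLieHom.comp h') (by
    rw [← hh']
    ext x
    exact congrArg p (e.apply_symm_apply (h' x)))
  rw [← this]
  ext x
  exact (e.apply_symm_apply (h' x)).symm

/-- Two central extensions that lift uniquely to themselves and to each other are uniquely
isomorphic. -/
theorem existsUnique_lieEquiv_of_existsUnique_lift {P L : Type*} [LieRing P] [LieAlgebra k P]
    [LieRing L] [LieAlgebra k L] {π : P →ₗ⁅k⁆ g} {f : L →ₗ⁅k⁆ g}
    (hPP : ∃! h : P →ₗ⁅k⁆ P, π.comp h = π) (hLL : ∃! h : L →ₗ⁅k⁆ L, f.comp h = f)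
    (hPL : ∃! h : P →ₗ⁅k⁆ L, f.comp h = π) (hLP : ∃! h : L →ₗ⁅k⁆ P, π.comp h = f) :
    ∃! e : P ≃ₗ⁅k⁆ L, f.comp e.toLieHom = π := by
  obtain ⟨φ, hφ, hφu⟩ := hPL
  obtain ⟨ψ, hψ, -⟩ := hLP
  have h₁ : ψ.comp φ = LieHom.id := hPP.unique
    (by ext x; exact (LieHom.congr_fun hψ (φ x)).trans (LieHom.congr_fun hφ x)) (by ext x; rfl)
  have h₂ : φ.comp ψ = LieHom.id := hLL.unique
    (by ext x; exact (LieHom.congr_fun hφ (ψ x)).trans (LieHom.congr_fun hψ x)) (by ext x; rfl)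
  refine ⟨{ φ with
    invFun := ψ
    left_inv := LieHom.congr_fun h₁
    right_inv := LieHom.congr_fun h₂ }, hφ, fun e he => ?_⟩
  ext x
  exact LieHom.congr_fun (hφu e.toLieHom he) x

end Uniqueness

theorem lemma3p5 (k : Type u) (R : Type v) [CommRing k] [Ring R] [Algebra k R] [Module.Free k R] :
    ∃ π : SlPresented k R →ₗ⁅k⁆ slAlg k R 3,
      (∀ (i j : Fin 3) (h : i ≠ j) (s : R),
        (π (presentedX k i j h s) : Matrix (Fin 3) (Fin 3) R) = Matrix.single i j s) ∧
      IsUniversalCentralExtension.{w} k π ∧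
      ∀ (L : Type w') [LieRing L] [LieAlgebra k L] (f : L →ₗ⁅k⁆ slAlg k R 3),
        IsUniversalCentralExtension.{max u v w'} k f →
          ∃! e : SlPresented k R ≃ₗ⁅k⁆ L, f.comp e.toLieHom = π := by
  refine ⟨presentedProj k R, fun i j h s => ?_, isUniversalCentralExtension_presentedProj k R,
    fun L _ _ f hf => ?_⟩
  · rw [presentedProj_presentedX, coe_slE]
  · have hπ := isCentralExtension_presentedProj k R
    -- The universe in which f is tested contains lifts of both L and the presented algebra, so the
    -- `ULift` transfer supplies both maps out of L.
    exact existsUnique_lieEquiv_of_existsUnique_lift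
      ((isUniversalCentralExtension_presentedProj k R).existsUnique_lift _ _ hπ)
      (IsUniversalCentralExtension.existsUnique_lift_of_ulift.{w', max u v} hf L f
        hf.isCentralExtension)
      ((isUniversalCentralExtension_presentedProj k R).existsUnique_lift _ _ hf.isCentralExtension)
      (IsUniversalCentralExtension.existsUnique_lift_of_ulift.{max u v, w'} hf _ _ hπ)
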